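/- **Setting.** A generalised probabilistic theory (GPT) assigns to every system $A$ a compact convex state space $\mathcal S_A$ in a real vector space $V_A$, a set of effects (linear functionals on $V_A$ that take values in $[0,1]$ on $\mathcal S_A$) containing a unit effect $u_A$ with $u_A(s)=1$ for all $s\in\mathcal S_A$, a set of allowed finite-outcome measurements (families of effects summing to $u_A$, closed under coarse-graining and relabelling), and transformations (acting linearly, mapping states to states, closed under composition, and such that a transformation followed by a measurement is a measurement). Systems $A,B$ can be composed to a joint system $AB$ with product states, product measurements with $(e\otimes f)(s\otimes t)=e(s)f(t)$, parallel transformations, reduced states and post-measurement states; independent systems can be prepared next to a given one; and every finite alphabet is represented by a classical system, whose state space is a simplex and whose composition with any system contains only separable states. Local tomography is not assumed. *Box world* is the GPT whose systems are finite collections of elementary boxes with finitely many inputs and outputs, whose states are all no-signalling conditional distributions, and whose effects, measurements and transformations are all linear ones compatible with the state spaces. **Scenario.** In the Information Causality scenario post-selected on Bob's question $R\in\{1,2\}$, finite random variables $X_1,X_2$ have an arbitrary joint distribution, and Alice and Bob share a state of a joint system $A_ZA_Y$ of a GPT $G$. Given $X_1=x_1$, $X_2=x_2$, Alice obtains the message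 $Z$ (with finite alphabet) as the outcome of a joint measurement on the classical systems $X_1,X_2$ (in the states $x_1,x_2$) and on $A_Z$. For $i\in\{1,2\}$, Bob obtains $Y_{|R=i}$ (with finite alphabet) as the outcome of a joint measurement, which may depend on $i$, on the classical system $Z$ and on $A_Y$; the variables $Y_{|R=1}$ and $Y_{|R=2}$ are alternatives, only one of which is generated. $H$ denotes the Shannon entropy (in bits) and $I(U:V)=H(U)+H(V)-H(UV)$. **Statement.** (a) For every GPT $G$ and every such strategy with resources from $G$, $$I(X_1X_2:Y_{|R=1}Z)\le H(Z)\qquad\text{and}\qquad I(X_1X_2:Y_{|R=2}Z)\le H(Z).$$ (b) Information Causality itself fails in box world: there is a strategy with box-world resources in which $X_1,X_2$ are independent uniform bits, $Z$ and $Y_{|R=i}$ are bits, and $$I(X_1:Y_{|R=1})+I(X_2:Y_{|R=2})>H(Z).$$ -/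

import Mathlib

/-! ## Shannon entropies of finite distributions (in bits) -/

/-- Shannon entropy `-∑ p log₂ p` of a finite distribution, with `0 log₂ 0 = 0`. -/
noncomputable def shannonEntropy {α : Type} [Fintype α] (p : α → ℝ) : ℝ :=
  -∑ a, p a * Real.logb 2 (p a)

/-- The law of the random variable `f` under the weights `P` on the finite sample space `Ω`. -/
noncomputable def lawOf {Ω α : Type} [Fintype Ω] (P : Ω → ℝ) (f : Ω → α) : α → ℝ :=
  open Classical in fun a => ∑ ω, if f ω = a then P ω else 0

/-- Shannon mutual information `I(f : g) = H(f) + H(g) - H(f, g)` under `P`. -/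
noncomputable def mutualInfo {Ω α β : Type} [Fintype Ω] [Fintype α] [Fintype β]
    (P : Ω → ℝ) (f : Ω → α) (g : Ω → β) : ℝ :=
  shannonEntropy (lawOf P f) + shannonEntropy (lawOf P g)
    - shannonEntropy (lawOf P fun ω => (f ω, g ω))

/-! ## Generalised probabilistic theories -/

universe u v w

/-- A generalised probabilistic theory: systems with compact convex state spaces, effects,
finite-outcome measurements, transformations, composition of systems (with product states, product
effects and parallel transformations), reduced and post-measurement states, and classical systems.
No local tomography is assumed, and nothing forces the joint state spaces to be minimal or maximal. -/
structure GPT where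
  /-- the systems of the theory -/
  Sys : Type u
  /-- the real vector space in which the states of a system live -/
  V : Sys → Type v
  [addCommGroupV : ∀ A, AddCommGroup (V A)]
  [moduleV : ∀ A, Module ℝ (V A)]
  [topV : ∀ A, TopologicalSpace (V A)]
  [topGroupV : ∀ A, IsTopologicalAddGroup (V A)]
  [contSMulV : ∀ A, ContinuousSMul ℝ (V A)]
  [t2V : ∀ A, T2Space (V A)]
  -- state spaces
  State : ∀ A, Set (V A)
  convex_state : ∀ A, Convex ℝ (State A)
  isCompact_state : ∀ A, IsCompact (State A)
  -- effects
  Effect : ∀ A, Set (V A →ₗ[ℝ] ℝ)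
  effect_mem_Icc : ∀ {A e s}, e ∈ Effect A → s ∈ State A → e s ∈ Set.Icc (0 : ℝ) 1
  /-- the unit effect -/
  unit : ∀ A, V A →ₗ[ℝ] ℝ
  unit_mem : ∀ A, unit A ∈ Effect A
  unit_state : ∀ {A s}, s ∈ State A → unit A s = 1
  /-- the allowed measurements with outcomes in a finite type `ι` -/
  Meas : ∀ (A : Sys) (ι : Type) [Fintype ι], Set (ι → (V A →ₗ[ℝ] ℝ))
  meas_effect : ∀ {A} {ι : Type} [Fintype ι] {M : ι → (V A →ₗ[ℝ] ℝ)},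
    M ∈ Meas A ι → ∀ i, M i ∈ Effect A
  meas_sum : ∀ {A} {ι : Type} [Fintype ι] {M : ι → (V A →ₗ[ℝ] ℝ)},
    M ∈ Meas A ι → ∑ i, M i = unit A
  /-- closure under coarse-graining and relabelling -/
  meas_coarse : ∀ {A} {ι κ : Type} [Fintype ι] [Fintype κ] [DecidableEq κ]
    {M : ι → (V A →ₗ[ℝ] ℝ)}, M ∈ Meas A ι → ∀ F : ι → κ,
    (fun k => ∑ i with F i = k, M i) ∈ Meas A κ
  /-- the transformations; each acts linearly on states, and its action on the system alone need not
  determine its action on a part of a joint system -/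
  Trans : Sys → Sys → Type w
  act : ∀ {A B}, Trans A B → (V A →ₗ[ℝ] V B)
  act_state : ∀ {A B s} (T : Trans A B), s ∈ State A → act T s ∈ State B
  idTrans : ∀ A, Trans A A
  act_idTrans : ∀ A, act (idTrans A) = LinearMap.id
  compTrans : ∀ {A B C}, Trans B C → Trans A B → Trans A C
  act_compTrans : ∀ {A B C} (S : Trans B C) (T : Trans A B),
    act (compTrans S T) = act S ∘ₗ act T
  /-- a transformation followed by a measurement is a measurement -/
  meas_trans : ∀ {A B} {ι : Type} [Fintype ι] {M : ι → (V B →ₗ[ℝ] ℝ)},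
    M ∈ Meas B ι → ∀ T : Trans A B, (fun i => M i ∘ₗ act T) ∈ Meas A ι
  /-- the joint system `AB` -/
  comp : Sys → Sys → Sys
  /-- product states `s_A ⊗ s_B` -/
  prodState : ∀ A B, V A →ₗ[ℝ] V B →ₗ[ℝ] V (comp A B)
  prodState_mem : ∀ {A B s t}, s ∈ State A → t ∈ State B → prodState A B s t ∈ State (comp A B)
  /-- product effects `e ⊗ f` -/
  prodEffect : ∀ A B, (V A →ₗ[ℝ] ℝ) →ₗ[ℝ] (V B →ₗ[ℝ] ℝ) →ₗ[ℝ] (V (comp A B) →ₗ[ℝ] ℝ)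
  prodEffect_prodState : ∀ {A B e f s t}, e ∈ Effect A → f ∈ Effect B → s ∈ State A →
    t ∈ State B → prodEffect A B e f (prodState A B s t) = e s * f t
  prodMeas_mem : ∀ {A B} {ι κ : Type} [Fintype ι] [Fintype κ] {M : ι → (V A →ₗ[ℝ] ℝ)}
    {N : κ → (V B →ₗ[ℝ] ℝ)}, M ∈ Meas A ι → N ∈ Meas B κ →
    (fun x : ι × κ => prodEffect A B (M x.1) (N x.2)) ∈ Meas (comp A B) (ι × κ)
  /-- parallel transformations `T ⊗ S` -/
  prodTrans : ∀ {A B C D}, Trans A B → Trans C D → Trans (comp A C) (comp B D)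
  prodTrans_prodState : ∀ {A B C D s t} (T : Trans A B) (S : Trans C D), s ∈ State A →
    t ∈ State C → act (prodTrans T S) (prodState A C s t) = prodState B D (act T s) (act S t)
  prodEffect_prodTrans : ∀ {A B C D e f s} (T : Trans A B) (S : Trans C D), e ∈ Effect B →
    f ∈ Effect D → s ∈ State (comp A C) →
    prodEffect B D e f (act (prodTrans T S) s) = prodEffect A C (e ∘ₗ act T) (f ∘ₗ act S) s
  /-- preparing an independent system next to a given one is a transformation -/
  prepare : ∀ {A}, State A → ∀ B, Trans B (comp A B)
  act_prepare : ∀ {A B} (s : State A) (t : V B), act (prepare s B) t = prodState A B s t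
  /-- the map `e ⊗ I_B` (an effect applied to the first subsystem only) -/
  applyLeft : ∀ A B, (V A →ₗ[ℝ] ℝ) →ₗ[ℝ] (V (comp A B) →ₗ[ℝ] V B)
  /-- the map `I_A ⊗ f` (an effect applied to the second subsystem only) -/
  applyRight : ∀ A B, (V B →ₗ[ℝ] ℝ) →ₗ[ℝ] (V (comp A B) →ₗ[ℝ] V A)
  effect_applyLeft : ∀ {A B e f s}, e ∈ Effect A → f ∈ Effect B → s ∈ State (comp A B) →
    f (applyLeft A B e s) = prodEffect A B e f s
  effect_applyRight : ∀ {A B e f s}, e ∈ Effect A → f ∈ Effect B → s ∈ State (comp A B) →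
    e (applyRight A B f s) = prodEffect A B e f s
  -- reduced states
  reducedRight_mem : ∀ {A B s}, s ∈ State (comp A B) → applyLeft A B (unit A) s ∈ State B
  reducedLeft_mem : ∀ {A B s}, s ∈ State (comp A B) → applyRight A B (unit B) s ∈ State A
  -- post-measurement states
  postRight_mem : ∀ {A B s} {ι : Type} [Fintype ι] {M : ι → (V A →ₗ[ℝ] ℝ)}, M ∈ Meas A ι →
    s ∈ State (comp A B) → ∀ i, prodEffect A B (M i) (unit B) s ≠ 0 →
    (prodEffect A B (M i) (unit B) s)⁻¹ • applyLeft A B (M i) s ∈ State B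
  postLeft_mem : ∀ {A B s} {ι : Type} [Fintype ι] {N : ι → (V B →ₗ[ℝ] ℝ)}, N ∈ Meas B ι →
    s ∈ State (comp A B) → ∀ i, prodEffect A B (unit A) (N i) s ≠ 0 →
    (prodEffect A B (unit A) (N i) s)⁻¹ • applyRight A B (N i) s ∈ State A
  /-- the classical system with a finite alphabet `ι` -/
  cl : ∀ (ι : Type) [Fintype ι] [Nonempty ι], Sys
  /-- the deterministic states of a classical system -/
  pt : ∀ {ι : Type} [Fintype ι] [Nonempty ι], ι → V (cl ι)
  /-- the standard classical measurement -/
  readout : ∀ {ι : Type} [Fintype ι] [Nonempty ι], ι → (V (cl ι) →ₗ[ℝ] ℝ)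
  readout_mem : ∀ {ι : Type} [Fintype ι] [Nonempty ι], (readout : ι → _) ∈ Meas (cl ι) ι
  readout_pt : ∀ {ι : Type} [Fintype ι] [Nonempty ι] [DecidableEq ι] (i j : ι),
    readout i (pt j) = if i = j then 1 else 0
  state_cl : ∀ {ι : Type} [Fintype ι] [Nonempty ι],
    State (cl ι) = convexHull ℝ (Set.range (pt : ι → V (cl ι)))
  -- composing with a classical system only yields separable states
  separable_left : ∀ {ι : Type} [Fintype ι] [Nonempty ι] {B : Sys},
    State (comp (cl ι) B) ⊆
      convexHull ℝ {w | ∃ s ∈ State (cl ι), ∃ t ∈ State B, w = prodState _ _ s t}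
  separable_right : ∀ {ι : Type} [Fintype ι] [Nonempty ι] {B : Sys},
    State (comp B (cl ι)) ⊆
      convexHull ℝ {w | ∃ s ∈ State B, ∃ t ∈ State (cl ι), w = prodState _ _ s t}

attribute [instance] GPT.addCommGroupV GPT.moduleV GPT.topV GPT.topGroupV GPT.contSMulV GPT.t2V

theorem GPT.pt_mem (G : GPT.{u, v, w}) {ι : Type} [Fintype ι] [Nonempty ι] (i : ι) :
    G.pt i ∈ G.State (G.cl ι) := by
  rw [G.state_cl]
  exact subset_convexHull ℝ _ ⟨i, rfl⟩

/-! ## The post-selected Information Causality scenario -/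

/-- A strategy in the Information Causality causal structure, post-selected on the parentless
variable `R ∈ {1, 2}`, with a resource from the theory `G`.  The edges are `X₁ → X₂`, `X₁ → Z`,
`X₂ → Z`, `A → Z`, and `A → Y_{|R=i}`, `Z → Y_{|R=i}` for both `i` (indexed by `Fin 2`).  The
unobserved node `A` is a state of a joint system, with one subsystem for Alice (who produces `Z`)
and one for Bob (who produces one of the two alternatives `Y_{|R=i}`).  Each output is the outcome
of a joint measurement on the classical parents of the node and on the subsystem of `A`. -/
structure ICStrategy (G : GPT.{u, v, w}) (X₁ X₂ Z Y : Type) [Fintype X₁] [Fintype X₂] [Fintype Z]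
    [Fintype Y] [Nonempty X₁] [Nonempty X₂] [Nonempty Z] where
  /-- the joint distribution of `X₁` and `X₂`, which may be correlated -/
  input : X₁ × X₂ → ℝ
  input_mem : input ∈ stdSimplex ℝ (X₁ × X₂)
  /-- the subsystem of the resource held by Alice -/
  AZ : G.Sys
  /-- the subsystem of the resource held by Bob -/
  AY : G.Sys
  /-- the state of the resource -/
  resource : G.V (G.comp AZ AY)
  resource_mem : resource ∈ G.State (G.comp AZ AY)
  /-- the measurement at `Z` -/
  measZ : Z → (G.V (G.comp (G.comp (G.cl X₁) (G.cl X₂)) AZ) →ₗ[ℝ] ℝ)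
  measZ_mem : measZ ∈ G.Meas (G.comp (G.comp (G.cl X₁) (G.cl X₂)) AZ) Z
  /-- the two alternative measurements at `Y` -/
  measY : Fin 2 → Y → (G.V (G.comp (G.cl Z) AY) →ₗ[ℝ] ℝ)
  measY_mem : ∀ i, measY i ∈ G.Meas (G.comp (G.cl Z) AY) Y

namespace ICStrategy

variable {G : GPT.{u, v, w}} {X₁ X₂ Z Y : Type} [Fintype X₁] [Fintype X₂] [Fintype Z]
  [Fintype Y] [Nonempty X₁] [Nonempty X₂] [Nonempty Z] (S : ICStrategy G X₁ X₂ Z Y)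

/-- The joint state of `((X₁ X₂) A_Z) A_Y` when `X₁ = x₁` and `X₂ = x₂`. -/
noncomputable def stateGiven (x : X₁ × X₂) :
    G.V (G.comp (G.comp (G.comp (G.cl X₁) (G.cl X₂)) S.AZ) S.AY) :=
  G.act (G.prodTrans
    (G.prepare ⟨G.prodState _ _ (G.pt x.1) (G.pt x.2),
      G.prodState_mem (G.pt_mem x.1) (G.pt_mem x.2)⟩ S.AZ) (G.idTrans S.AY)) S.resource

/-- `p(z | x₁ x₂)`. -/
noncomputable def probZ (x : X₁ × X₂) (z : Z) : ℝ :=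
  G.prodEffect _ _ (S.measZ z) (G.unit S.AY) (S.stateGiven x)

/-- The state of `A_Y` conditioned on `x₁`, `x₂` and on the outcome `z` (a state if
`p(z | x₁ x₂) ≠ 0`). -/
noncomputable def postState (x : X₁ × X₂) (z : Z) : G.V S.AY :=
  (S.probZ x z)⁻¹ • G.applyLeft _ _ (S.measZ z) (S.stateGiven x)

/-- The distribution of `Z`. -/
noncomputable def lawZ (z : Z) : ℝ := ∑ x, S.input x * S.probZ x z

/-- The joint distribution of the coexisting observed variables `(X₁, X₂, Z, Y_{|R=i})`:
`p(x₁ x₂) p(z | x₁ x₂) p(y | x₁ x₂ z)`. -/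
noncomputable def joint (i : Fin 2) (ω : X₁ × X₂ × Z × Y) : ℝ :=
  S.input (ω.1, ω.2.1) * S.probZ (ω.1, ω.2.1) ω.2.2.1 *
    S.measY i ω.2.2.2 (G.prodState _ S.AY (G.pt ω.2.2.1) (S.postState (ω.1, ω.2.1) ω.2.2.1))

end ICStrategy

/-! ## Box world -/

/-- An elementary box: finitely many inputs, and finitely many outputs for each input. -/
structure Box where
  In : Type
  Out : In → Type
  [fintypeIn : Fintype In]
  [nonemptyIn : Nonempty In]
  [fintypeOut : ∀ x, Fintype (Out x)]
  [nonemptyOut : ∀ x, Nonempty (Out x)]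

attribute [instance] Box.fintypeIn Box.nonemptyIn Box.fintypeOut Box.nonemptyOut

/-- Functions `P(outputs | inputs)` on a finite index set (inputs together with outputs), the subspace
of those that satisfy the no-signalling equations, and the total probability functional. -/
structure BoxSpace where
  Idx : Type
  [fintypeIdx : Fintype Idx]
  NS : Submodule ℝ (Idx → ℝ)
  total : (Idx → ℝ) →ₗ[ℝ] ℝ

attribute [instance] BoxSpace.fintypeIdx

/-- The space of an elementary box: the sum over the outputs does not depend on the input. -/
noncomputable def Box.space (b : Box) : BoxSpace :=
  { Idx := (x : b.In) × b.Out x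
    NS :=
      { carrier := {P | ∀ x x', ∑ a, P ⟨x, a⟩ = ∑ a, P ⟨x', a⟩}
        add_mem' := fun {P Q} hP hQ x x' => by
          simp only [Pi.add_apply, Finset.sum_add_distrib]; rw [hP x x', hQ x x']
        zero_mem' := fun x x' => by simp
        smul_mem' := fun c P hP x x' => by
          simp only [Pi.smul_apply, ← Finset.smul_sum]; rw [hP x x'] }
    total :=
      { toFun := fun P => ∑ a, P ⟨Classical.arbitrary b.In, a⟩
        map_add' := fun P Q => by simp [Finset.sum_add_distrib]
        map_smul' := fun c P => by simp [Finset.mul_sum] } }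

namespace BoxSpace

/-- The space of a joint system: the no-signalling equations of each part hold for all fixed inputs
and outputs of the other part. -/
noncomputable def comp (A B : BoxSpace) : BoxSpace where
  Idx := A.Idx × B.Idx
  NS :=
    { carrier := {P | (∀ b, (fun a => P (a, b)) ∈ A.NS) ∧ ∀ a, (fun b => P (a, b)) ∈ B.NS}
      add_mem' := fun {P Q} hP hQ =>
        ⟨fun b => A.NS.add_mem (hP.1 b) (hQ.1 b), fun a => B.NS.add_mem (hP.2 a) (hQ.2 a)⟩
      zero_mem' := ⟨fun _ => A.NS.zero_mem, fun _ => B.NS.zero_mem⟩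
      smul_mem' := fun c P hP =>
        ⟨fun b => A.NS.smul_mem c (hP.1 b), fun a => B.NS.smul_mem c (hP.2 a)⟩ }
  total :=
    { toFun := fun P => B.total fun b => A.total fun a => P (a, b)
      map_add' := fun P Q => by
        rw [← map_add]; congr 1; funext b; exact map_add A.total _ _
      map_smul' := fun c P => by
        simp only [RingHom.id_apply]
        rw [← map_smul]; congr 1; funext b; exact map_smul A.total c _ }

/-- The unit effect: the total probability. -/
noncomputable def unit (A : BoxSpace) : A.NS →ₗ[ℝ] ℝ := A.total ∘ₗ A.NS.subtype

/-- Unnormalised states: nonnegative no-signalling functions. -/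
def Nonneg {A : BoxSpace} (s : A.NS) : Prop := ∀ i, 0 ≤ s.1 i

/-- The states: all no-signalling conditional probability distributions. -/
def State (A : BoxSpace) : Set A.NS := {s | Nonneg s ∧ unit A s = 1}

/-- The effects: all linear functionals with values in `[0, 1]` on the states (written with
unnormalised states). -/
def Effect (A : BoxSpace) : Set (A.NS →ₗ[ℝ] ℝ) :=
  {e | ∀ s : A.NS, Nonneg s → 0 ≤ e s ∧ e s ≤ unit A s}

/-- The measurements: all finite families of effects that sum to the unit effect. -/
def Meas (A : BoxSpace) (ι : Type) [Fintype ι] : Set (ι → (A.NS →ₗ[ℝ] ℝ)) :=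
  {M | (∀ i, M i ∈ Effect A) ∧ ∑ i, M i = unit A}

/-- The transformations: all linear maps that take states to states (written with unnormalised
states). -/
def Trans (A B : BoxSpace) : Set (A.NS →ₗ[ℝ] B.NS) :=
  {T | unit B ∘ₗ T = unit A ∧ ∀ s : A.NS, Nonneg s → Nonneg (T s)}

variable {A B C D : BoxSpace}

/-- `s(·, b)`. -/
noncomputable def sliceL (b : B.Idx) : (A.comp B).NS →ₗ[ℝ] A.NS where
  toFun s := ⟨fun a => s.1 (a, b), s.2.1 b⟩
  map_add' _ _ := rfl
  map_smul' _ _ := rfl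

/-- `s(a, ·)`. -/
noncomputable def sliceR (a : A.Idx) : (A.comp B).NS →ₗ[ℝ] B.NS where
  toFun s := ⟨fun b => s.1 (a, b), s.2.2 a⟩
  map_add' _ _ := rfl
  map_smul' _ _ := rfl

theorem exists_coeff (e : A.NS →ₗ[ℝ] ℝ) : ∃ c : A.Idx → ℝ, ∀ s : A.NS, e s = ∑ a, c a * s.1 a := by
  classical
  obtain ⟨g, hg⟩ := LinearMap.exists_extend e
  refine ⟨fun a => g (Pi.single a 1), fun s => ?_⟩
  rw [← hg, LinearMap.comp_apply, Submodule.subtype_apply, LinearMap.pi_apply_eq_sum_univ g s.1]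
  refine Finset.sum_congr rfl fun a _ => ?_
  rw [smul_eq_mul, mul_comm]
  congr 2
  funext j
  simp [Pi.single_apply, eq_comm]

theorem applyLeft_aux (e : A.NS →ₗ[ℝ] ℝ) (s : (A.comp B).NS) :
    (fun b => e (sliceL b s)) ∈ B.NS := by
  obtain ⟨c, hc⟩ := exists_coeff e
  have : (fun b => e (sliceL b s)) = ∑ a, c a • (sliceR a s).1 := by
    funext b
    rw [hc, Finset.sum_apply]
    rfl
  rw [this]
  exact Submodule.sum_mem _ fun a _ => B.NS.smul_mem _ (sliceR a s).2

theorem applyRight_aux (f : B.NS →ₗ[ℝ] ℝ) (s : (A.comp B).NS) :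
    (fun a => f (sliceR a s)) ∈ A.NS := by
  obtain ⟨c, hc⟩ := exists_coeff f
  have : (fun a => f (sliceR a s)) = ∑ b, c b • (sliceL b s).1 := by
    funext a
    rw [hc, Finset.sum_apply]
    rfl
  rw [this]
  exact Submodule.sum_mem _ fun b _ => A.NS.smul_mem _ (sliceL b s).2

/-- `e ⊗ I_B`. -/
noncomputable def applyLeft (A B : BoxSpace) : (A.NS →ₗ[ℝ] ℝ) →ₗ[ℝ] ((A.comp B).NS →ₗ[ℝ] B.NS) :=
  LinearMap.mk₂ ℝ (fun e s => ⟨fun b => e (sliceL b s), applyLeft_aux e s⟩)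
    (fun _ _ _ => rfl) (fun _ _ _ => rfl)
    (fun e s t => Subtype.ext (funext fun b => by
      change e (sliceL b (s + t)) = e (sliceL b s) + e (sliceL b t)
      rw [map_add, map_add]))
    (fun c e s => Subtype.ext (funext fun b => by
      change e (sliceL b (c • s)) = c • e (sliceL b s)
      rw [map_smul, map_smul]))

/-- `I_A ⊗ f`. -/
noncomputable def applyRight (A B : BoxSpace) : (B.NS →ₗ[ℝ] ℝ) →ₗ[ℝ] ((A.comp B).NS →ₗ[ℝ] A.NS) :=
  LinearMap.mk₂ ℝ (fun f s => ⟨fun a => f (sliceR a s), applyRight_aux f s⟩)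
    (fun _ _ _ => rfl) (fun _ _ _ => rfl)
    (fun f s t => Subtype.ext (funext fun a => by
      change f (sliceR a (s + t)) = f (sliceR a s) + f (sliceR a t)
      rw [map_add, map_add]))
    (fun c f s => Subtype.ext (funext fun a => by
      change f (sliceR a (c • s)) = c • f (sliceR a s)
      rw [map_smul, map_smul]))

/-- `e ⊗ f`. -/
noncomputable def prodEffect (A B : BoxSpace) :
    (A.NS →ₗ[ℝ] ℝ) →ₗ[ℝ] (B.NS →ₗ[ℝ] ℝ) →ₗ[ℝ] ((A.comp B).NS →ₗ[ℝ] ℝ) :=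
  LinearMap.mk₂ ℝ (fun e f => f ∘ₗ applyLeft A B e)
    (fun e e' f => by rw [map_add, LinearMap.comp_add])
    (fun c e f => by rw [map_smul, LinearMap.comp_smul])
    (fun e f f' => LinearMap.add_comp _ _ _)
    (fun c e f => LinearMap.smul_comp _ _ _)

theorem prodEffect_eq_right (e : A.NS →ₗ[ℝ] ℝ) (f : B.NS →ₗ[ℝ] ℝ) (s : (A.comp B).NS) :
    e (applyRight A B f s) = prodEffect A B e f s := by
  obtain ⟨c, hc⟩ := exists_coeff e
  obtain ⟨d, hd⟩ := exists_coeff f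
  change e (applyRight A B f s) = f (applyLeft A B e s)
  rw [hc, hd]
  change ∑ a, c a * f (sliceR a s) = ∑ b, d b * e (sliceL b s)
  simp only [hc, hd, Finset.mul_sum]
  rw [Finset.sum_comm]
  refine Finset.sum_congr rfl fun b _ => Finset.sum_congr rfl fun a _ => ?_
  change c a * (d b * s.1 (a, b)) = d b * (c a * s.1 (a, b))
  ring

theorem prodEffect_unit : prodEffect A B (unit A) (unit B) = unit (A.comp B) := rfl

/-- `s ⊗ t`. -/
noncomputable def prodState (A B : BoxSpace) : A.NS →ₗ[ℝ] B.NS →ₗ[ℝ] (A.comp B).NS :=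
  LinearMap.mk₂ ℝ (fun s t => ⟨fun i => s.1 i.1 * t.1 i.2,
      ⟨fun b => by
        have : (fun a => s.1 a * t.1 b) = t.1 b • s.1 := by
          funext a; exact mul_comm _ _
        rw [this]; exact A.NS.smul_mem _ s.2,
      fun a => B.NS.smul_mem (s.1 a) t.2⟩⟩)
    (fun s s' t => Subtype.ext (funext fun i => add_mul _ _ _))
    (fun c s t => Subtype.ext (funext fun i => mul_assoc _ _ _))
    (fun s t t' => Subtype.ext (funext fun i => mul_add _ _ _))
    (fun c s t => Subtype.ext (funext fun i => mul_left_comm _ _ _))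

theorem applyLeft_prodState (e : A.NS →ₗ[ℝ] ℝ) (s : A.NS) (t : B.NS) :
    applyLeft A B e (prodState A B s t) = e s • t := by
  refine Subtype.ext (funext fun b => ?_)
  change e (sliceL b (prodState A B s t)) = e s * t.1 b
  have : sliceL b (prodState A B s t) = t.1 b • s :=
    Subtype.ext (funext fun a => mul_comm (s.1 a) (t.1 b))
  rw [this, map_smul, smul_eq_mul, mul_comm]

theorem prodEffect_prodState (e : A.NS →ₗ[ℝ] ℝ) (f : B.NS →ₗ[ℝ] ℝ) (s : A.NS) (t : B.NS) :
    prodEffect A B e f (prodState A B s t) = e s * f t := by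
  change f (applyLeft A B e (prodState A B s t)) = _
  rw [applyLeft_prodState, map_smul, smul_eq_mul]

/-- `T ⊗ I`. -/
noncomputable def mapLeft (T : A.NS →ₗ[ℝ] B.NS) : (A.comp C).NS →ₗ[ℝ] (B.comp C).NS where
  toFun s := ⟨fun i => (T (sliceL i.2 s)).1 i.1,
    fun c => (T (sliceL c s)).2,
    fun b => applyLeft_aux (LinearMap.proj b ∘ₗ B.NS.subtype ∘ₗ T) s⟩
  map_add' s t := Subtype.ext (funext fun i => by
    change (T (sliceL i.2 (s + t))).1 i.1 = (T (sliceL i.2 s)).1 i.1 + (T (sliceL i.2 t)).1 i.1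
    rw [map_add, map_add]; rfl)
  map_smul' c s := Subtype.ext (funext fun i => by
    change (T (sliceL i.2 (c • s))).1 i.1 = c * (T (sliceL i.2 s)).1 i.1
    rw [map_smul, map_smul]; rfl)

/-- `I ⊗ S`. -/
noncomputable def mapRight (S : C.NS →ₗ[ℝ] D.NS) : (B.comp C).NS →ₗ[ℝ] (B.comp D).NS where
  toFun s := ⟨fun i => (S (sliceR i.1 s)).1 i.2,
    fun d => applyRight_aux (LinearMap.proj d ∘ₗ D.NS.subtype ∘ₗ S) s,
    fun b => (S (sliceR b s)).2⟩
  map_add' s t := Subtype.ext (funext fun i => by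
    change (S (sliceR i.1 (s + t))).1 i.2 = (S (sliceR i.1 s)).1 i.2 + (S (sliceR i.1 t)).1 i.2
    rw [map_add, map_add]; rfl)
  map_smul' c s := Subtype.ext (funext fun i => by
    change (S (sliceR i.1 (c • s))).1 i.2 = c * (S (sliceR i.1 s)).1 i.2
    rw [map_smul, map_smul]; rfl)

/-- `T ⊗ S`. -/
noncomputable def prodTrans (T : A.NS →ₗ[ℝ] B.NS) (S : C.NS →ₗ[ℝ] D.NS) :
    (A.comp C).NS →ₗ[ℝ] (B.comp D).NS := mapRight S ∘ₗ mapLeft T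

theorem prodEffect_mapLeft (T : A.NS →ₗ[ℝ] B.NS) (e : B.NS →ₗ[ℝ] ℝ) (f : C.NS →ₗ[ℝ] ℝ)
    (s : (A.comp C).NS) :
    prodEffect B C e f (mapLeft T s) = prodEffect A C (e ∘ₗ T) f s := rfl

theorem prodEffect_mapRight (S : C.NS →ₗ[ℝ] D.NS) (e : B.NS →ₗ[ℝ] ℝ) (f : D.NS →ₗ[ℝ] ℝ)
    (s : (B.comp C).NS) :
    prodEffect B D e f (mapRight S s) = prodEffect B C e (f ∘ₗ S) s := by
  rw [← prodEffect_eq_right, ← prodEffect_eq_right]; rfl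

theorem prodEffect_prodTrans (T : A.NS →ₗ[ℝ] B.NS) (S : C.NS →ₗ[ℝ] D.NS) (e : B.NS →ₗ[ℝ] ℝ)
    (f : D.NS →ₗ[ℝ] ℝ) (s : (A.comp C).NS) :
    prodEffect B D e f (prodTrans T S s) = prodEffect A C (e ∘ₗ T) (f ∘ₗ S) s :=
  (prodEffect_mapRight S e f (mapLeft T s)).trans (prodEffect_mapLeft T e (f ∘ₗ S) s)

theorem prodTrans_prodState (T : A.NS →ₗ[ℝ] B.NS) (S : C.NS →ₗ[ℝ] D.NS) (s : A.NS) (t : C.NS) :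
    prodTrans T S (prodState A C s t) = prodState B D (T s) (S t) := by
  have h1 : mapLeft T (prodState A C s t) = prodState B C (T s) t := by
    refine Subtype.ext (funext fun i => ?_)
    have h : sliceL i.2 (prodState A C s t) = t.1 i.2 • s :=
      Subtype.ext (funext fun a => mul_comm (s.1 a) (t.1 i.2))
    change (T (sliceL i.2 (prodState A C s t))).1 i.1 = (T s).1 i.1 * t.1 i.2
    rw [h, map_smul]
    exact mul_comm _ _
  have h2 : mapRight S (prodState B C (T s) t) = prodState B D (T s) (S t) := by
    refine Subtype.ext (funext fun i => ?_)
    have h : sliceR i.1 (prodState B C (T s) t) = (T s).1 i.1 • t := rfl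
    change (S (sliceR i.1 (prodState B C (T s) t))).1 i.2 = (T s).1 i.1 * (S t).1 i.2
    rw [h, map_smul]
    rfl
  change mapRight S (mapLeft T (prodState A C s t)) = _
  rw [h1, h2]

theorem nonneg_prodState {s : A.NS} {t : B.NS} (hs : Nonneg s) (ht : Nonneg t) :
    Nonneg (prodState A B s t) := fun i => mul_nonneg (hs i.1) (ht i.2)

theorem nonneg_applyLeft {e : A.NS →ₗ[ℝ] ℝ} (he : e ∈ Effect A) {s : (A.comp B).NS}
    (hs : Nonneg s) : Nonneg (applyLeft A B e s) :=
  fun b => (he (sliceL b s) fun a => hs (a, b)).1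

theorem nonneg_applyRight {f : B.NS →ₗ[ℝ] ℝ} (hf : f ∈ Effect B) {s : (A.comp B).NS}
    (hs : Nonneg s) : Nonneg (applyRight A B f s) :=
  fun a => (hf (sliceR a s) fun b => hs (a, b)).1

theorem unit_mem_aux (h : ∀ s : A.NS, Nonneg s → 0 ≤ unit A s) : unit A ∈ Effect A :=
  fun s hs => ⟨h s hs, le_rfl⟩

theorem meas_of_nonneg {ι : Type} [Fintype ι] {M : ι → (A.NS →ₗ[ℝ] ℝ)}
    (h0 : ∀ i s, Nonneg s → 0 ≤ M i s) (h1 : ∑ i, M i = unit A) : M ∈ Meas A ι := by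
  refine ⟨fun i s hs => ⟨h0 i s hs, ?_⟩, h1⟩
  rw [← h1, LinearMap.sum_apply]
  exact Finset.single_le_sum (f := fun j => M j s) (fun j _ => h0 j s hs) (Finset.mem_univ i)

theorem prodMeas_mem {ι κ : Type} [Fintype ι] [Fintype κ] {M : ι → (A.NS →ₗ[ℝ] ℝ)}
    {N : κ → (B.NS →ₗ[ℝ] ℝ)} (hM : M ∈ Meas A ι) (hN : N ∈ Meas B κ) :
    (fun x : ι × κ => prodEffect A B (M x.1) (N x.2)) ∈ Meas (A.comp B) (ι × κ) := by
  refine meas_of_nonneg (fun x s hs => (hN.1 x.2 _ (nonneg_applyLeft (hM.1 x.1) hs)).1) ?_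
  rw [Fintype.sum_prod_type, ← prodEffect_unit, ← hM.2, ← hN.2, map_sum (prodEffect A B),
    LinearMap.sum_apply]
  exact Finset.sum_congr rfl fun i _ => (map_sum (prodEffect A B (M i)) _ _).symm

theorem meas_coarse {ι κ : Type} [Fintype ι] [Fintype κ] [DecidableEq κ]
    {M : ι → (A.NS →ₗ[ℝ] ℝ)} (hM : M ∈ Meas A ι) (F : ι → κ) :
    (fun k => ∑ i with F i = k, M i) ∈ Meas A κ := by
  refine meas_of_nonneg (fun k s hs => ?_) ?_
  · rw [LinearMap.sum_apply]
    exact Finset.sum_nonneg fun i _ => (hM.1 i s hs).1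
  · rw [← hM.2]
    exact Finset.sum_fiberwise_of_maps_to (fun i _ => Finset.mem_univ (F i)) M

theorem meas_trans {T : A.NS →ₗ[ℝ] B.NS} {ι : Type} [Fintype ι] {M : ι → (B.NS →ₗ[ℝ] ℝ)}
    (hM : M ∈ Meas B ι) (hT : T ∈ Trans A B) : (fun i => M i ∘ₗ T) ∈ Meas A ι := by
  refine meas_of_nonneg (fun i s hs => (hM.1 i _ (hT.2 s hs)).1) ?_
  rw [← hT.1, ← hM.2]
  exact LinearMap.ext fun s => by simp [LinearMap.sum_apply]

theorem prodTrans_mem {T : A.NS →ₗ[ℝ] B.NS} {S : C.NS →ₗ[ℝ] D.NS} (hT : T ∈ Trans A B)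
    (hS : S ∈ Trans C D) : prodTrans T S ∈ Trans (A.comp C) (B.comp D) := by
  refine ⟨LinearMap.ext fun s => ?_, fun s hs => ?_⟩
  · rw [← prodEffect_unit, ← prodEffect_unit, LinearMap.comp_apply, prodEffect_prodTrans, hT.1, hS.1]
  · have h : Nonneg (mapLeft T s : (B.comp C).NS) :=
      fun i => hT.2 (sliceL i.2 s) (fun a => hs (a, i.2)) i.1
    exact fun i => hS.2 (sliceR i.1 (mapLeft T s)) (fun c => h (i.1, c)) i.2

theorem trans_state {T : A.NS →ₗ[ℝ] B.NS} {s : A.NS} (hT : T ∈ Trans A B) (hs : s ∈ State A) :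
    T s ∈ State B :=
  ⟨hT.2 s hs.1, (LinearMap.congr_fun hT.1 s).trans hs.2⟩

theorem prodState_mem {s : A.NS} {t : B.NS} (hs : s ∈ State A) (ht : t ∈ State B) :
    prodState A B s t ∈ State (A.comp B) :=
  ⟨nonneg_prodState hs.1 ht.1, by
    rw [← prodEffect_unit, prodEffect_prodState, hs.2, ht.2, one_mul]⟩

theorem prepare_mem {s : A.NS} (hs : s ∈ State A) : prodState A B s ∈ Trans B (A.comp B) :=
  ⟨LinearMap.ext fun t => by
    rw [LinearMap.comp_apply, ← prodEffect_unit, prodEffect_prodState, hs.2, one_mul],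
  fun _ ht => nonneg_prodState hs.1 ht⟩

theorem postRight_mem {e : A.NS →ₗ[ℝ] ℝ} (he : e ∈ Effect A) {s : (A.comp B).NS}
    (hs : s ∈ State (A.comp B)) (hB : unit B ∈ Effect B)
    (h : prodEffect A B e (unit B) s ≠ 0) :
    (prodEffect A B e (unit B) s)⁻¹ • applyLeft A B e s ∈ State B := by
  have hn := nonneg_applyLeft he hs.1
  refine ⟨fun b => mul_nonneg (inv_nonneg.2 (hB _ hn).1) (hn b), ?_⟩
  rw [map_smul, smul_eq_mul]
  exact inv_mul_cancel₀ h

theorem postLeft_mem {f : B.NS →ₗ[ℝ] ℝ} (hf : f ∈ Effect B) {s : (A.comp B).NS}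
    (hs : s ∈ State (A.comp B)) (hA : unit A ∈ Effect A)
    (h : prodEffect A B (unit A) f s ≠ 0) :
    (prodEffect A B (unit A) f s)⁻¹ • applyRight A B f s ∈ State A := by
  have hn := nonneg_applyRight hf hs.1
  rw [← prodEffect_eq_right] at h ⊢
  refine ⟨fun a => mul_nonneg (inv_nonneg.2 (hA _ hn).1) (hn a), ?_⟩
  rw [map_smul, smul_eq_mul]
  exact inv_mul_cancel₀ h

theorem convex_state (A : BoxSpace) : Convex ℝ (State A) := by
  intro s hs t ht a b ha hb hab
  refine ⟨fun i => add_nonneg (mul_nonneg ha (hs.1 i)) (mul_nonneg hb (ht.1 i)), ?_⟩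
  rw [map_add, map_smul, map_smul, hs.2, ht.2, smul_eq_mul, smul_eq_mul, mul_one, mul_one, hab]

theorem isCompact_state (h : ∀ s : A.NS, Nonneg s → ∀ i, s.1 i ≤ unit A s) :
    IsCompact (State A) := by
  have hemb : Topology.IsClosedEmbedding (Subtype.val : A.NS → (A.Idx → ℝ)) :=
    (Submodule.closed_of_finiteDimensional A.NS).isClosedEmbedding_subtypeVal
  have hK : IsCompact (Set.univ.pi fun _ : A.Idx => Set.Icc (0 : ℝ) 1) :=
    isCompact_univ_pi fun _ => isCompact_Icc
  refine (hemb.isCompact_preimage hK).of_isClosed_subset ?_ ?_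
  · refine IsClosed.inter ?_ ?_
    · have : {s : A.NS | Nonneg s} = ⋂ i, {s : A.NS | 0 ≤ s.1 i} := by
        ext s; simp [Nonneg]
      change IsClosed {s : A.NS | Nonneg s}
      rw [this]
      exact isClosed_iInter fun i =>
        isClosed_le continuous_const ((continuous_apply i).comp continuous_subtype_val)
    · exact isClosed_eq (LinearMap.continuous_of_finiteDimensional (unit A)) continuous_const
  · intro s hs i _
    exact ⟨hs.1 i, (h s hs.1 i).trans hs.2.le⟩

end BoxSpace

/-- The elementary box with a single input: a classical system. -/
def Box.classical (ι : Type) [Fintype ι] [Nonempty ι] : Box where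
  In := Unit
  Out := fun _ => ι

/-- The systems of box world: finite collections of elementary boxes. -/
inductive BoxSys : Type 1
  | box : Box → BoxSys
  | comp : BoxSys → BoxSys → BoxSys

namespace BoxSys

open BoxSpace

/-- The no-signalling functions of a system. -/
noncomputable def space : BoxSys → BoxSpace
  | box b => b.space
  | comp A B => (space A).comp (space B)

theorem unit_bound : ∀ A : BoxSys, ∀ s : (space A).NS, Nonneg s →
    0 ≤ BoxSpace.unit (space A) s ∧ ∀ i, s.1 i ≤ BoxSpace.unit (space A) s
  | box b => fun (s : b.space.NS) hs => by
    refine ⟨Finset.sum_nonneg fun a _ => hs ⟨_, a⟩, ?_⟩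
    rintro ⟨x, a⟩
    have h1 : s.1 ⟨x, a⟩ ≤ ∑ a, s.1 ⟨x, a⟩ :=
      Finset.single_le_sum (f := fun a => s.1 ⟨x, a⟩) (fun a _ => hs ⟨x, a⟩) (Finset.mem_univ a)
    exact h1.trans_eq (s.2 x _)
  | comp A B => fun (s : ((space A).comp (space B)).NS) hs => by
    have hA : BoxSpace.unit (space A) ∈ BoxSpace.Effect (space A) :=
      unit_mem_aux fun t ht => (unit_bound A t ht).1
    have hB := unit_bound B _ (nonneg_applyLeft hA hs)
    refine ⟨hB.1, fun i => ?_⟩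
    have h1 := (unit_bound A (sliceL i.2 s) fun a => hs (a, i.2)).2 i.1
    exact h1.trans (hB.2 i.2)

theorem unit_mem (A : BoxSys) : BoxSpace.unit (space A) ∈ BoxSpace.Effect (space A) :=
  unit_mem_aux fun t ht => (unit_bound A t ht).1

theorem sum_mem_of_convex {ι E : Type} [Fintype ι] [AddCommGroup E] [Module ℝ E] {K : Set E} (hK : Convex ℝ K)
    (w : ι → E) (t : ι → ℝ) (ht : ∀ i, 0 ≤ t i) (h1 : ∑ i, t i = 1) (h0 : ∀ i, t i = 0 → w i = 0)
    (hk : ∀ i, t i ≠ 0 → (t i)⁻¹ • w i ∈ K) : ∑ i, w i ∈ K := by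
  classical
  have hw : ∑ i, w i = ∑ i with t i ≠ 0, t i • ((t i)⁻¹ • w i) := by
    rw [Finset.sum_filter]
    refine Finset.sum_congr rfl fun i _ => ?_
    split_ifs with h
    · rw [smul_inv_smul₀ h]
    · exact h0 i (not_not.1 h)
  rw [hw]
  refine hK.sum_mem (fun i _ => ht i) ?_ fun i hi => hk i (Finset.mem_filter.1 hi).2
  rw [← h1, Finset.sum_filter]
  exact Finset.sum_congr rfl fun i _ => by split_ifs with h <;> simp_all

section Classical

variable {ι : Type} [Fintype ι] [Nonempty ι]

/-- The deterministic distribution at `i`. -/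
noncomputable def pt (i : ι) : (space (box (Box.classical ι))).NS :=
  open Classical in ⟨fun j => if j.2 = i then 1 else 0, fun _ _ => rfl⟩

/-- The probability of the output `i`. -/
noncomputable def readout (i : ι) : (space (box (Box.classical ι))).NS →ₗ[ℝ] ℝ where
  toFun s := s.1 ⟨(), i⟩
  map_add' _ _ := rfl
  map_smul' _ _ := rfl

theorem readout_pt [DecidableEq ι] (i j : ι) : readout i (pt j) = if i = j then 1 else 0 := by
  change (@ite ℝ (i = j) (Classical.propDecidable _) 1 0) = _
  congr

theorem sum_readout :
    ∑ i : ι, readout i = BoxSpace.unit (space (box (Box.classical ι))) :=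
  LinearMap.ext fun s => by rw [LinearMap.sum_apply]; rfl

theorem readout_mem :
    (readout : ι → _) ∈ BoxSpace.Meas (space (box (Box.classical ι))) ι :=
  meas_of_nonneg (fun i _ hs => hs ⟨(), i⟩) sum_readout

theorem eq_sum_pt (s : (space (box (Box.classical ι))).NS) :
    s = ∑ i : ι, readout i s • pt i := by
  classical
  have key : ∀ j : ι, readout j s = readout j (∑ i : ι, readout i s • pt i) := fun j => by
    simp only [map_sum, map_smul, readout_pt, smul_eq_mul, mul_ite, mul_one, mul_zero,
      Finset.sum_ite_eq, Finset.mem_univ, if_true]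
  exact Subtype.ext (funext fun k => key k.2)

theorem pt_mem (i : ι) : pt i ∈ BoxSpace.State (space (box (Box.classical ι))) := by
  classical
  refine ⟨fun j => ?_, ?_⟩
  · change (0 : ℝ) ≤ ite _ 1 0
    split_ifs <;> norm_num
  · rw [← sum_readout, LinearMap.sum_apply]
    simp [readout_pt]

theorem state_cl : BoxSpace.State (space (box (Box.classical ι))) =
    convexHull ℝ (Set.range (pt : ι → _)) := by
  apply Set.Subset.antisymm
  · intro s hs
    rw [eq_sum_pt s]
    refine (convex_convexHull ℝ _).sum_mem (fun i _ => hs.1 ⟨(), i⟩) ?_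
      fun i _ => subset_convexHull ℝ _ ⟨i, rfl⟩
    rw [← hs.2, ← sum_readout, LinearMap.sum_apply]
  · exact convexHull_min (Set.range_subset_iff.2 pt_mem) (BoxSpace.convex_state _)

theorem eq_zero_of_unit {B : BoxSys} {s : (space B).NS} (hs : Nonneg s)
    (h : BoxSpace.unit (space B) s = 0) : s = 0 :=
  Subtype.ext (funext fun i => le_antisymm (((unit_bound B s hs).2 i).trans_eq h) (hs i))

theorem separable_left {B : BoxSys} :
    BoxSpace.State ((space (box (Box.classical ι))).comp (space B)) ⊆
      convexHull ℝ {w | ∃ s ∈ BoxSpace.State (space (box (Box.classical ι))),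
        ∃ t ∈ BoxSpace.State (space B), w = BoxSpace.prodState _ _ s t} := by
  classical
  intro s hs
  have hr : ∀ i : ι, readout i ∈ BoxSpace.Effect _ := fun i => readout_mem.1 i
  have hsum : s = ∑ i : ι, BoxSpace.prodState _ _ (pt i)
      (BoxSpace.applyLeft _ (space B) (readout i) s) := by
    refine Subtype.ext (funext ?_)
    rintro ⟨j, b⟩
    have h := congrArg (LinearMap.proj j ∘ₗ (space (box (Box.classical ι))).NS.subtype)
      (eq_sum_pt (sliceL b s))
    rw [map_sum] at h
    refine h.trans (Eq.trans (Finset.sum_congr rfl fun i _ => ?_)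
      (map_sum (LinearMap.proj (R := ℝ) (φ := fun _ => ℝ) (j, b) ∘ₗ
        ((space (box (Box.classical ι))).comp (space B)).NS.subtype) _ _).symm)
    exact mul_comm _ _
  rw [hsum]
  refine sum_mem_of_convex (convex_convexHull ℝ _) _
    (fun i => BoxSpace.prodEffect _ _ (readout i) (BoxSpace.unit (space B)) s)
    (fun i => (unit_mem B _ (nonneg_applyLeft (hr i) hs.1)).1) ?_ (fun i hi => ?_) fun i hi => ?_
  · rw [← LinearMap.sum_apply, ← LinearMap.sum_apply, ← map_sum, sum_readout, prodEffect_unit]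
    exact hs.2
  · rw [eq_zero_of_unit (nonneg_applyLeft (hr i) hs.1) hi, map_zero]
  · refine subset_convexHull ℝ _ ⟨pt i, pt_mem i, _, postRight_mem (hr i) hs (unit_mem B) hi, ?_⟩
    rw [map_smul]

theorem separable_right {B : BoxSys} :
    BoxSpace.State ((space B).comp (space (box (Box.classical ι)))) ⊆
      convexHull ℝ {w | ∃ s ∈ BoxSpace.State (space B),
        ∃ t ∈ BoxSpace.State (space (box (Box.classical ι))), w = BoxSpace.prodState _ _ s t} := by
  classical
  intro s hs
  have hr : ∀ i : ι, readout i ∈ BoxSpace.Effect _ := fun i => readout_mem.1 i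
  have hsum : s = ∑ i : ι, BoxSpace.prodState _ _
      (BoxSpace.applyRight (space B) _ (readout i) s) (pt i) := by
    refine Subtype.ext (funext ?_)
    rintro ⟨b, j⟩
    have h := congrArg (LinearMap.proj j ∘ₗ (space (box (Box.classical ι))).NS.subtype)
      (eq_sum_pt (sliceR b s))
    rw [map_sum] at h
    refine h.trans (Eq.trans (Finset.sum_congr rfl fun i _ => ?_)
      (map_sum (LinearMap.proj (R := ℝ) (φ := fun _ => ℝ) (b, j) ∘ₗ
        ((space B).comp (space (box (Box.classical ι)))).NS.subtype) _ _).symm)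
    exact rfl
  rw [hsum]
  refine sum_mem_of_convex (convex_convexHull ℝ _) _
    (fun i => BoxSpace.prodEffect _ _ (BoxSpace.unit (space B)) (readout i) s)
    (fun i => ?_) ?_ (fun i hi => ?_) fun i hi => ?_
  · exact (hr i _ (nonneg_applyLeft (unit_mem B) hs.1)).1
  · rw [← LinearMap.sum_apply, ← map_sum, sum_readout, prodEffect_unit]
    exact hs.2
  · rw [← prodEffect_eq_right] at hi
    rw [eq_zero_of_unit (nonneg_applyRight (hr i) hs.1) hi, map_zero, LinearMap.zero_apply]
  · refine subset_convexHull ℝ _ ⟨_, postLeft_mem (hr i) hs (unit_mem B) hi, pt i, pt_mem i, ?_⟩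
    rw [map_smul, LinearMap.smul_apply]

end Classical

end BoxSys

/-- Box world. -/
noncomputable def boxWorld : GPT.{1, 0, 0} where
  Sys := BoxSys
  V A := A.space.NS
  State A := A.space.State
  convex_state A := A.space.convex_state
  isCompact_state A := A.space.isCompact_state fun s hs => (A.unit_bound s hs).2
  Effect A := A.space.Effect
  effect_mem_Icc := fun he hs => ⟨(he _ hs.1).1, (he _ hs.1).2.trans_eq hs.2⟩
  unit A := A.space.unit
  unit_mem A := A.unit_mem
  unit_state hs := hs.2
  Meas A ι _ := A.space.Meas ι
  meas_effect hM := hM.1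
  meas_sum hM := hM.2
  meas_coarse hM F := BoxSpace.meas_coarse hM F
  Trans A B := A.space.Trans B.space
  act T := T.1
  act_state T hs := BoxSpace.trans_state T.2 hs
  idTrans _ := ⟨LinearMap.id, LinearMap.comp_id _, fun _ hs => hs⟩
  act_idTrans _ := rfl
  compTrans S T := ⟨S.1 ∘ₗ T.1, by rw [← LinearMap.comp_assoc, S.2.1, T.2.1],
    fun s hs => S.2.2 _ (T.2.2 s hs)⟩
  act_compTrans _ _ := rfl
  meas_trans hM T := BoxSpace.meas_trans hM T.2
  comp := BoxSys.comp
  prodState A B := A.space.prodState B.space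
  prodState_mem hs ht := BoxSpace.prodState_mem hs ht
  prodEffect A B := A.space.prodEffect B.space
  prodEffect_prodState _ _ _ _ := BoxSpace.prodEffect_prodState _ _ _ _
  prodMeas_mem hM hN := BoxSpace.prodMeas_mem hM hN
  prodTrans T S := ⟨BoxSpace.prodTrans T.1 S.1, BoxSpace.prodTrans_mem T.2 S.2⟩
  prodTrans_prodState T S _ _ := BoxSpace.prodTrans_prodState T.1 S.1 _ _
  prodEffect_prodTrans T S _ _ _ := BoxSpace.prodEffect_prodTrans T.1 S.1 _ _ _
  prepare {A} s B := ⟨A.space.prodState B.space s.1, BoxSpace.prepare_mem s.2⟩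
  act_prepare _ _ := rfl
  applyLeft A B := A.space.applyLeft B.space
  applyRight A B := A.space.applyRight B.space
  effect_applyLeft _ _ _ := rfl
  effect_applyRight _ _ _ := BoxSpace.prodEffect_eq_right _ _ _
  reducedRight_mem := fun {A B s} hs =>
    ⟨BoxSpace.nonneg_applyLeft A.unit_mem hs.1, hs.2⟩
  reducedLeft_mem := fun {A B s} hs =>
    ⟨BoxSpace.nonneg_applyRight B.unit_mem hs.1,
      (BoxSpace.prodEffect_eq_right (A := A.space) (B := B.space) _ _ s).trans hs.2⟩
  postRight_mem := fun {A B s} _ _ _ hM hs i h =>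
    BoxSpace.postRight_mem (A := A.space) (B := B.space) (hM.1 i) hs B.unit_mem h
  postLeft_mem := fun {A B s} _ _ _ hN hs i h =>
    BoxSpace.postLeft_mem (A := A.space) (B := B.space) (hN.1 i) hs A.unit_mem h
  cl ι _ _ := BoxSys.box (Box.classical ι)
  pt := BoxSys.pt
  readout := BoxSys.readout
  readout_mem := BoxSys.readout_mem
  readout_pt := BoxSys.readout_pt
  state_cl := BoxSys.state_cl
  separable_left := @fun _ _ _ _ => BoxSys.separable_left
  separable_right := @fun _ _ _ _ => BoxSys.separable_right

/-! Part (a) rests only on no-signalling and classical entropy estimates. Fix Bob's question. Once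
the classical registers are absorbed into the measurements, Alice measures `effectZ x` on her share
and Bob measures `effectY i z` on his, so p(z, y | x) = (e_{x,z} ⊗ f_{z,y})(s). Keep Bob's effect
f_{z,y} fixed and add the nonnegative terms of Alice's other outcomes: her effects sum to the unit,
hence p(z, y | x) ≤ r(z, y) := (u ⊗ f_{z,y})(s). This bound no longer contains x, and r(z, ·) is a
probability distribution for every z: it is what Bob would see if he guessed the message z
(`ICStrategy.probZY_le`).

The rest is classical (`entropy_add_entropy_sub_le`). Inserting p(z, y | x) ≤ r(z, y) into the
logarithm gives I(X : ZY) ≤ ∑ p(z, y) log (r(z, y) / p(z, y)). Gibbs' inequality against the weights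
p(z) r(z, y) bounds the right side by -∑ p(z) log p(z) = H(Z). Neither local tomography nor a chain
rule for a GPT entropy enters.

Part (b) is van Dam's protocol. Alice feeds x₁ + x₂ into a Popescu–Rohrlich box and sends z = a +
x₁; Bob feeds in 0 or 1 and outputs y = z + b. The box relation a + b = (x₁ + x₂) · input turns y
into x₁ or x₂ exactly, so each mutual information is one bit, while the message has entropy one bit.
-/

/-! ### Entropy inequalities for finite weights -/

/-- Gibbs' inequality, from log t ≤ t - 1 at t = q / b. The support condition `h` cannot be dropped:
with the convention log 0 = 0, a zero of q where b is positive would not make the left side -∞. -/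
theorem sum_mul_logb_le {ι : Type} [Fintype ι] {b q : ι → ℝ} (hb : ∀ i, 0 ≤ b i)
    (hq : ∀ i, 0 ≤ q i) (h : ∀ i, 0 < b i → 0 < q i) (hs : ∑ i, q i ≤ ∑ i, b i) :
    ∑ i, b i * Real.logb 2 (q i) ≤ ∑ i, b i * Real.logb 2 (b i) := by
  have key : ∀ i, b i * Real.log (q i) ≤ b i * Real.log (b i) + (q i - b i) := fun i => by
    rcases (hb i).eq_or_lt with h0 | h0
    · rw [← h0]; simpa using hq i
    · have hl := Real.log_le_sub_one_of_pos (div_pos (h i h0) h0)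
      rw [Real.log_div (h i h0).ne' h0.ne'] at hl
      have hm := mul_le_mul_of_nonneg_left hl h0.le
      have hd : b i * (q i / b i - 1) = q i - b i := by field_simp
      linarith
  have hsum := Finset.sum_le_sum fun i (_ : i ∈ Finset.univ) => key i
  rw [Finset.sum_add_distrib, Finset.sum_sub_distrib] at hsum
  simp only [Real.logb, ← mul_div_assoc, ← Finset.sum_div]
  exact div_le_div_of_nonneg_right (by linarith) (Real.log_nonneg one_le_two)

/-- If the conditional distributions of `(Z, Y)` given `X` are bounded by `r z y`, where each `r z`
is a (sub)distribution, then `I(X : ZY) ≤ H(Z)`. -/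
theorem entropy_add_entropy_sub_le {X Z Y : Type} [Fintype X] [Fintype Z] [Fintype Y]
    {P : X × Z × Y → ℝ} {a : X → ℝ} {b : Z × Y → ℝ} {c : Z → ℝ} {r : Z × Y → ℝ}
    (hP : ∀ t, 0 ≤ P t) (ha : ∀ x, ∑ t, P (x, t) = a x) (hb : ∀ t, ∑ x, P (x, t) = b t)
    (hc : ∀ z, ∑ y, b (z, y) = c z) (hr0 : ∀ t, 0 ≤ r t) (hr : ∀ z, ∑ y, r (z, y) ≤ 1)
    (hPr : ∀ x t, P (x, t) ≤ a x * r t) :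
    shannonEntropy a + shannonEntropy b - shannonEntropy P ≤ shannonEntropy c := by
  have hb0 : ∀ t, 0 ≤ b t := fun t => hb t ▸ Finset.sum_nonneg fun x _ => hP _
  have hc0 : ∀ z, 0 ≤ c z := fun z => hc z ▸ Finset.sum_nonneg fun y _ => hb0 _
  have ha0 : ∀ x, 0 ≤ a x := fun x => ha x ▸ Finset.sum_nonneg fun t _ => hP _
  -- Positive b t means that some P (x, t) is positive, and this lies below a x * r t.
  have hrpos : ∀ t, 0 < b t → 0 < r t := fun t ht => by
    rw [← hb t] at ht
    obtain ⟨x, -, hx⟩ := Finset.exists_lt_of_sum_lt (f := fun _ => (0 : ℝ)) (by simpa using ht)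
    exact pos_of_mul_pos_right (hx.trans_le (hPr x t)) (ha0 x)
  have hcpos : ∀ t : Z × Y, 0 < b t → 0 < c t.1 := fun t ht => by
    rw [← hc]
    exact ht.trans_le (Finset.single_le_sum (f := fun y => b (t.1, y)) (fun y _ => hb0 _)
      (Finset.mem_univ t.2))
  have hterm : ∀ x t, P (x, t) * Real.logb 2 (P (x, t)) ≤
      P (x, t) * Real.logb 2 (a x) + P (x, t) * Real.logb 2 (r t) := fun x t => by
    rcases (hP (x, t)).eq_or_lt with h0 | h0
    · simp [← h0]
    · have hpos := h0.trans_le (hPr x t)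
      rw [← mul_add, ← Real.logb_mul (left_ne_zero_of_mul hpos.ne')
        (right_ne_zero_of_mul hpos.ne')]
      exact mul_le_mul_of_nonneg_left
        (Real.logb_le_logb_of_le one_lt_two h0 (hPr x t)) h0.le
  -- Averaging `hterm`: -H(P) ≤ -H(a) + ∑ b log r, because x has marginal a and t has marginal b.
  have h1 : ∑ t, P t * Real.logb 2 (P t) ≤
      ∑ x, a x * Real.logb 2 (a x) + ∑ t, b t * Real.logb 2 (r t) := by
    have hA : ∑ x, a x * Real.logb 2 (a x) = ∑ x, ∑ t, P (x, t) * Real.logb 2 (a x) :=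
      Finset.sum_congr rfl fun x _ => by rw [← ha, Finset.sum_mul]
    have hB : ∑ t, b t * Real.logb 2 (r t) = ∑ x, ∑ t, P (x, t) * Real.logb 2 (r t) := by
      rw [Finset.sum_comm]
      exact Finset.sum_congr rfl fun t _ => by rw [← hb, Finset.sum_mul]
    rw [hA, hB, Fintype.sum_prod_type, ← Finset.sum_add_distrib]
    refine Finset.sum_le_sum fun x _ => ?_
    rw [← Finset.sum_add_distrib]
    exact Finset.sum_le_sum fun t _ => hterm x t
  -- Gibbs' inequality with comparison weights c(z) r(z, y): their total does not exceed that of b,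
  -- since r(z, ·) has mass at most 1 for each z.
  have h2 : ∑ t, b t * Real.logb 2 (c t.1 * r t) ≤ ∑ t, b t * Real.logb 2 (b t) := by
    refine sum_mul_logb_le hb0 (fun t => mul_nonneg (hc0 _) (hr0 t))
      (fun t ht => mul_pos (hcpos t ht) (hrpos t ht)) ?_
    rw [Fintype.sum_prod_type, Fintype.sum_prod_type]
    refine Finset.sum_le_sum fun z _ => ?_
    simp only [hc, ← Finset.mul_sum]
    exact mul_le_of_le_one_right (hc0 z) (hr z)
  -- Splitting the logarithm makes ∑ b log r appear again; it cancels against the one in `h1` and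
  -- leaves H(c).
  have h3 : ∑ t, b t * Real.logb 2 (c t.1 * r t) =
      ∑ z, c z * Real.logb 2 (c z) + ∑ t, b t * Real.logb 2 (r t) := by
    have hC : ∑ z, c z * Real.logb 2 (c z) = ∑ t : Z × Y, b t * Real.logb 2 (c t.1) := by
      rw [Fintype.sum_prod_type]
      exact Finset.sum_congr rfl fun z _ => by simp only [← Finset.sum_mul, hc]
    rw [hC, ← Finset.sum_add_distrib]
    refine Finset.sum_congr rfl fun t _ => ?_
    rcases (hb0 t).eq_or_lt with h0 | h0
    · simp [← h0]
    · rw [← mul_add, Real.logb_mul (hcpos t h0).ne' (hrpos t h0).ne']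
  simp only [shannonEntropy]
  linarith

/-! ### Laws of random variables and relabelling -/

theorem lawOf_apply {Ω α : Type} [Fintype Ω] [DecidableEq α] (P : Ω → ℝ) (f : Ω → α) (a : α) :
    lawOf P f a = ∑ ω, if f ω = a then P ω else 0 :=
  Finset.sum_congr rfl fun ω _ => by congr

theorem lawOf_injective {Ω α : Type} [Fintype Ω] (P : Ω → ℝ) {f : Ω → α}
    (hf : Function.Injective f) (ω : Ω) : lawOf P f (f ω) = P ω := by
  classical
  rw [lawOf_apply, Fintype.sum_eq_single ω fun ω' h => if_neg fun h' => h (hf h'), if_pos rfl]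

theorem shannonEntropy_comp_equiv {α β : Type} [Fintype α] [Fintype β] (e : α ≃ β) (p : β → ℝ) :
    shannonEntropy (fun a => p (e a)) = shannonEntropy p := by
  simp only [shannonEntropy]
  rw [e.sum_comp fun b => p b * Real.logb 2 (p b)]

/-! ### Local measurements on bipartite states -/

theorem GPT.sum_unit_comp_act (G : GPT.{u, v, w}) {A B : G.Sys} {ι : Type} [Fintype ι]
    {M : ι → (G.V B →ₗ[ℝ] ℝ)} (hM : M ∈ G.Meas B ι) (T : G.Trans A B) :
    ∑ i, M i ∘ₗ G.act T = G.unit A :=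
  G.meas_sum (G.meas_trans hM T)

theorem GPT.prodEffect_nonneg (G : GPT.{u, v, w}) {A B : G.Sys} {ι κ : Type} [Fintype ι]
    [Fintype κ] {M : ι → (G.V A →ₗ[ℝ] ℝ)} {N : κ → (G.V B →ₗ[ℝ] ℝ)} (hM : M ∈ G.Meas A ι)
    (hN : N ∈ G.Meas B κ) {s : G.V (G.comp A B)} (hs : s ∈ G.State (G.comp A B)) (i : ι) (k : κ) :
    0 ≤ G.prodEffect A B (M i) (N k) s :=
  (G.effect_mem_Icc (G.meas_effect (G.prodMeas_mem hM hN) (i, k)) hs).1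

theorem GPT.sum_prodEffect_left (G : GPT.{u, v, w}) {A B : G.Sys} {ι : Type} [Fintype ι]
    {M : ι → (G.V A →ₗ[ℝ] ℝ)} (hM : M ∈ G.Meas A ι) (f : G.V B →ₗ[ℝ] ℝ) (s : G.V (G.comp A B)) :
    ∑ i, G.prodEffect A B (M i) f s = G.prodEffect A B (G.unit A) f s := by
  rw [← G.meas_sum hM, map_sum, LinearMap.sum_apply, LinearMap.sum_apply]

theorem GPT.sum_prodEffect_right (G : GPT.{u, v, w}) {A B : G.Sys} {κ : Type} [Fintype κ]
    {N : κ → (G.V B →ₗ[ℝ] ℝ)} (hN : N ∈ G.Meas B κ) (e : G.V A →ₗ[ℝ] ℝ) (s : G.V (G.comp A B)) :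
    ∑ k, G.prodEffect A B e (N k) s = G.prodEffect A B e (G.unit B) s := by
  rw [← G.meas_sum hN, map_sum, LinearMap.sum_apply]

/-- The axioms do not list u_A ⊗ u_B = u_{AB}. It follows by bilinearity from the fact that a
product of measurements sums to u_{AB}, which is why a measurement on each side must be supplied. -/
theorem GPT.prodEffect_unit_unit (G : GPT.{u, v, w}) {A B : G.Sys} {ι κ : Type} [Fintype ι]
    [Fintype κ] {M : ι → (G.V A →ₗ[ℝ] ℝ)} {N : κ → (G.V B →ₗ[ℝ] ℝ)} (hM : M ∈ G.Meas A ι)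
    (hN : N ∈ G.Meas B κ) {s : G.V (G.comp A B)} (hs : s ∈ G.State (G.comp A B)) :
    G.prodEffect A B (G.unit A) (G.unit B) s = 1 := by
  rw [← G.unit_state hs, ← G.meas_sum (G.prodMeas_mem hM hN), Fintype.sum_prod_type,
    LinearMap.sum_apply, ← G.sum_prodEffect_left hM]
  refine Finset.sum_congr rfl fun i _ => ?_
  rw [LinearMap.sum_apply]
  exact (G.sum_prodEffect_right hN _ _).symm

/-! ### No-signalling and the bound for one of Bob's questions -/

namespace ICStrategy

variable {G : GPT.{u, v, w}} {X₁ X₂ Z Y : Type} [Fintype X₁] [Fintype X₂] [Fintype Z]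
  [Fintype Y] [Nonempty X₁] [Nonempty X₂] [Nonempty Z] (S : ICStrategy G X₁ X₂ Z Y)

/-- The measurement on `A_Z` that Alice performs when `X₁ = x₁` and `X₂ = x₂`. -/
noncomputable def effectZ (x : X₁ × X₂) (z : Z) : G.V S.AZ →ₗ[ℝ] ℝ :=
  S.measZ z ∘ₗ G.prodState _ S.AZ (G.prodState _ _ (G.pt x.1) (G.pt x.2))

/-- The measurement on `A_Y` that Bob performs upon receiving the message `z`. -/
noncomputable def effectY (i : Fin 2) (z : Z) (y : Y) : G.V S.AY →ₗ[ℝ] ℝ :=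
  S.measY i y ∘ₗ G.prodState _ S.AY (G.pt z)

theorem act_prepare_eq {A B : G.Sys} (s : G.State A) : G.act (G.prepare s B) = G.prodState A B s :=
  LinearMap.ext (G.act_prepare s)

/-- Placing the classical inputs next to A_Z is a transformation, and a transformation followed by a
measurement is a measurement. -/
theorem effectZ_mem (x : X₁ × X₂) : S.effectZ x ∈ G.Meas S.AZ Z := by
  have h := G.meas_trans S.measZ_mem (G.prepare ⟨G.prodState _ _ (G.pt x.1) (G.pt x.2),
      G.prodState_mem (G.pt_mem x.1) (G.pt_mem x.2)⟩ S.AZ)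
  rwa [act_prepare_eq] at h

theorem effectY_mem (i : Fin 2) (z : Z) : S.effectY i z ∈ G.Meas S.AY Y := by
  have h := G.meas_trans (S.measY_mem i) (G.prepare ⟨G.pt z, G.pt_mem z⟩ S.AY)
  rwa [act_prepare_eq] at h

/-- Heisenberg picture: the dependence on x moves from the state to Alice's effects, so that a
single shared state serves all inputs. -/
theorem prodEffect_stateGiven (x : X₁ × X₂) (z : Z) {f : G.V S.AY →ₗ[ℝ] ℝ}
    (hf : f ∈ G.Effect S.AY) :
    G.prodEffect _ _ (S.measZ z) f (S.stateGiven x) =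
      G.prodEffect _ _ (S.effectZ x z) f S.resource := by
  rw [stateGiven, G.prodEffect_prodTrans _ _ (G.meas_effect S.measZ_mem z) hf S.resource_mem,
    G.act_idTrans, LinearMap.comp_id, act_prepare_eq, effectZ]

/-- `p(z, y | x₁ x₂)`. -/
noncomputable def probZY (i : Fin 2) (x : X₁ × X₂) (z : Z) (y : Y) : ℝ :=
  G.prodEffect _ _ (S.effectZ x z) (S.effectY i z y) S.resource

theorem probZ_eq (x : X₁ × X₂) (z : Z) :
    S.probZ x z = G.prodEffect _ _ (S.effectZ x z) (G.unit S.AY) S.resource :=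
  S.prodEffect_stateGiven x z (G.unit_mem _)

theorem probZY_nonneg (i : Fin 2) (x : X₁ × X₂) (z : Z) (y : Y) : 0 ≤ S.probZY i x z y :=
  G.prodEffect_nonneg (S.effectZ_mem x) (S.effectY_mem i z) S.resource_mem z y

theorem sum_probZY (i : Fin 2) (x : X₁ × X₂) (z : Z) : ∑ y, S.probZY i x z y = S.probZ x z :=
  (G.sum_prodEffect_right (S.effectY_mem i z) _ _).trans (S.probZ_eq x z).symm

/-- Conditioning on z and multiplying by p(z | x) cancels, which removes the post-measurement state
from the description. -/
theorem joint_eq (i : Fin 2) (ω : X₁ × X₂ × Z × Y) :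
    S.joint i ω = S.input (ω.1, ω.2.1) * S.probZY i (ω.1, ω.2.1) ω.2.2.1 ω.2.2.2 := by
  obtain ⟨x₁, x₂, z, y⟩ := ω
  have hY := G.meas_effect (S.effectY_mem i z) y
  have h : S.measY i y (G.prodState _ S.AY (G.pt z) (S.postState (x₁, x₂) z)) =
      (S.probZ (x₁, x₂) z)⁻¹ * S.probZY i (x₁, x₂) z y := by
    rw [postState, map_smul, map_smul, smul_eq_mul]
    congr 1
    refine (G.effect_applyLeft (G.meas_effect S.measZ_mem z) hY
      (G.act_state _ S.resource_mem)).trans ?_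
    exact S.prodEffect_stateGiven _ _ hY
  simp only [joint]
  rw [h, mul_assoc]
  congr 1
  -- If p(z | x) = 0 the post-measurement state is the default value 0; the identity still holds
  -- because the nonnegative p(z, y | x) sum to 0 over y.
  by_cases h0 : S.probZ (x₁, x₂) z = 0
  · rw [h0, zero_mul]
    have := S.sum_probZY i (x₁, x₂) z
    rw [h0] at this
    exact ((Finset.sum_eq_zero_iff_of_nonneg fun y _ => S.probZY_nonneg i _ z y).1 this y
      (Finset.mem_univ y)).symm
  · rw [mul_inv_cancel_left₀ h0]

theorem sum_sum_probZY (i : Fin 2) (x : X₁ × X₂) : ∑ z, ∑ y, S.probZY i x z y = 1 := by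
  -- Evaluating u ⊗ u needs some measurement on Bob's side; the one for an arbitrary message serves.
  obtain ⟨z₀⟩ := ‹Nonempty Z›
  simp only [S.sum_probZY, probZ_eq]
  rw [G.sum_prodEffect_left (S.effectZ_mem x)]
  exact G.prodEffect_unit_unit (S.effectZ_mem x) (S.effectY_mem i z₀) S.resource_mem

/-- The decisive no-signalling step. Bob's effect stays the one for the message z while Alice's
outcome z' runs over all messages; the sum contains the term z' = z, and it does not depend on x
because Alice's effects add up to the unit. -/
theorem probZY_le (i : Fin 2) (x : X₁ × X₂) (z : Z) (y : Y) :
    S.probZY i x z y ≤ G.prodEffect _ _ (G.unit S.AZ) (S.effectY i z y) S.resource := by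
  rw [← G.sum_prodEffect_left (S.effectZ_mem x)]
  exact Finset.single_le_sum
    (f := fun z' => G.prodEffect _ _ (S.effectZ x z') (S.effectY i z y) S.resource)
    (fun z' _ => G.prodEffect_nonneg (S.effectZ_mem x) (S.effectY_mem i z) S.resource_mem z' y)
    (Finset.mem_univ z)

theorem mutualInfo_le (i : Fin 2) :
    mutualInfo (S.joint i) (fun ω => (ω.1, ω.2.1)) (fun ω => (ω.2.2.2, ω.2.2.1))
      ≤ shannonEntropy S.lawZ := by
  classical
  have hin := S.input_mem
  have hJ : ∀ x : X₁ × X₂, ∀ t : Z × Y,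
      S.joint i (x.1, x.2, t) = S.input x * S.probZY i x t.1 t.2 := fun x t => S.joint_eq i _
  have hX : lawOf (S.joint i) (fun ω => (ω.1, ω.2.1)) = S.input := by
    funext x
    rw [lawOf_apply, ← (Equiv.prodAssoc X₁ X₂ (Z × Y)).sum_comp, Fintype.sum_prod_type]
    refine (Fintype.sum_eq_single x fun x' h => Finset.sum_eq_zero fun t _ => if_neg h).trans ?_
    simp only [Equiv.prodAssoc_apply, if_true, hJ x, ← Finset.mul_sum, Fintype.sum_prod_type,
      S.sum_sum_probZY, mul_one]
  have hZY : ∀ t : Z × Y, lawOf (S.joint i) (fun ω => (ω.2.2.2, ω.2.2.1)) t.swap =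
      ∑ x, S.input x * S.probZY i x t.1 t.2 := fun t => by
    rw [lawOf_apply, ← (Equiv.prodAssoc X₁ X₂ (Z × Y)).sum_comp, Fintype.sum_prod_type]
    refine Finset.sum_congr rfl fun x _ => ?_
    refine (Fintype.sum_eq_single t fun t' h => if_neg fun h' => h (Prod.swap_injective h')).trans ?_
    rw [← hJ]
    exact if_pos rfl
  -- The mutual information lists (Y, Z), the entropy estimate (Z, Y); entropy is invariant under
  -- this swap.
  let e : (X₁ × X₂) × Z × Y ≃ (X₁ × X₂) × Y × Z := Equiv.prodCongr (Equiv.refl _) (Equiv.prodComm _ _)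
  have hXZY : ∀ t : (X₁ × X₂) × Z × Y,
      lawOf (S.joint i) (fun ω => ((ω.1, ω.2.1), (ω.2.2.2, ω.2.2.1))) (e t) =
      S.input t.1 * S.probZY i t.1 t.2.1 t.2.2 := fun t => by
    rw [← hJ]
    refine lawOf_injective (S.joint i)
      (f := fun ω : X₁ × X₂ × Z × Y => ((ω.1, ω.2.1), (ω.2.2.2, ω.2.2.1))) ?_ (t.1.1, t.1.2, t.2)
    rintro ⟨x₁, x₂, z, y⟩ ⟨x₁', x₂', z', y'⟩ h
    simp only [Prod.mk.injEq] at h ⊢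
    tauto
  rw [mutualInfo, hX, ← shannonEntropy_comp_equiv (Equiv.prodComm Z Y),
    ← shannonEntropy_comp_equiv e]
  refine entropy_add_entropy_sub_le
    (r := fun t => G.prodEffect _ _ (G.unit S.AZ) (S.effectY i t.1 t.2) S.resource)
    (fun t => ?_) (fun x => ?_) (fun t => ?_) (fun z => ?_) (fun t => ?_) (fun z => ?_)
    fun x t => ?_
  · rw [hXZY]
    exact mul_nonneg (hin.1 _) (S.probZY_nonneg _ _ _ _)
  · simp only [hXZY, ← Finset.mul_sum, Fintype.sum_prod_type, S.sum_sum_probZY, mul_one]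
  · simp only [hXZY]
    exact (hZY t).symm
  · have : ∀ y, lawOf (S.joint i) (fun ω => (ω.2.2.2, ω.2.2.1)) (Equiv.prodComm Z Y (z, y)) =
      ∑ x, S.input x * S.probZY i x z y := fun y => hZY (z, y)
    simp only [this, lawZ]
    rw [Finset.sum_comm]
    simp only [← Finset.mul_sum, S.sum_probZY]
  -- The bound r dominates the probability p(z, y | x) for any one input x.
  · exact (S.probZY_nonneg i (Classical.arbitrary _) t.1 t.2).trans (S.probZY_le _ _ _ _)
  · rw [G.sum_prodEffect_right (S.effectY_mem i z),
      G.prodEffect_unit_unit (S.effectZ_mem (Classical.arbitrary _)) (S.effectY_mem i z)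
        S.resource_mem]
  · rw [hXZY]
    exact mul_le_mul_of_nonneg_left (S.probZY_le _ _ _ _) (hin.1 _)

end ICStrategy

/-! ### The Popescu–Rohrlich box and van Dam's measurements -/

/-- An elementary box with a binary input and a binary output. -/
def Box.binary : Box where
  In := Bool
  Out := fun _ => Bool

namespace BoxSys

/-- The Popescu–Rohrlich box: outputs `a`, `b` with `a + b = x y` modulo `2`. -/
noncomputable def prBox : (space (comp (box Box.binary) (box Box.binary))).NS :=
  ⟨fun i : (Σ _ : Bool, Bool) × Σ _ : Bool, Bool =>
    if (i.1.2 ^^ i.2.2) = (i.1.1 && i.2.1) then 1 / 2 else 0, by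
    -- For given inputs and one given output, exactly one value of the other output satisfies the
    -- box relation, so every sum is 1/2.
    refine ⟨fun b => ?_, fun a => ?_⟩
    · obtain ⟨y, b⟩ := b
      change Bool at y
      change Bool at b
      change ∀ x x' : Bool, ∑ a : Bool, _ = ∑ a : Bool, _
      intro x x'
      cases b <;> cases y <;> cases x <;> cases x' <;> simp
    · obtain ⟨x, a⟩ := a
      change Bool at x
      change Bool at a
      change ∀ y y' : Bool, ∑ b : Bool, _ = ∑ b : Bool, _
      intro y y'
      cases a <;> cases x <;> cases y <;> cases y' <;> simp⟩

theorem prBox_mem :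
    prBox ∈ BoxSpace.State (space (comp (box Box.binary) (box Box.binary))) := by
  refine ⟨fun i => ?_, ?_⟩
  · change (0 : ℝ) ≤ ite _ _ _
    split_ifs <;> norm_num
  -- Proved for all inputs, since the unit effect is evaluated at unspecified ones.
  · have h : ∀ x y : Bool, ∑ b : Bool, ∑ a : Bool,
        (if (a ^^ b) = (x && y) then (1 / 2 : ℝ) else 0) = 1 := by
      intro x y
      cases x <;> cases y <;> norm_num
    exact h _ _

/-- Given the inputs `x₁`, `x₂`, feed `x₁ + x₂` into the box and announce its output plus `x₁`. -/
noncomputable def encode (z : Bool) :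
    (space (comp (comp (box (Box.classical Bool)) (box (Box.classical Bool)))
      (box Box.binary))).NS →ₗ[ℝ] ℝ where
  toFun s := ∑ x₁ : Bool, ∑ x₂ : Bool, s.1 ((⟨(), x₁⟩, ⟨(), x₂⟩), ⟨x₁ ^^ x₂, z ^^ x₁⟩)
  map_add' s t := by
    simp only [← Finset.sum_add_distrib]
    rfl
  map_smul' c s := by
    simp only [smul_eq_mul, Finset.mul_sum]
    rfl

/-- Given the message `z`, feed `i` into the box and announce its output plus `z`. -/
noncomputable def decode (i y : Bool) :
    (space (comp (box (Box.classical Bool)) (box Box.binary))).NS →ₗ[ℝ] ℝ where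
  toFun s := ∑ z : Bool, s.1 (⟨(), z⟩, ⟨i, z ^^ y⟩)
  map_add' s t := by
    simp only [← Finset.sum_add_distrib]
    rfl
  map_smul' c s := by
    simp only [smul_eq_mul, Finset.mul_sum]
    rfl

theorem encode_mem : encode ∈ BoxSpace.Meas (space (comp (comp (box (Box.classical Bool))
    (box (Box.classical Bool))) (box Box.binary))) Bool := by
  refine BoxSpace.meas_of_nonneg (fun z s hs => ?_) (LinearMap.ext fun s => ?_)
  · change 0 ≤ ∑ x₁ : Bool, ∑ x₂ : Bool, s.1 ((⟨(), x₁⟩, ⟨(), x₂⟩), ⟨x₁ ^^ x₂, z ^^ x₁⟩)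
    exact Finset.sum_nonneg fun x₁ _ => Finset.sum_nonneg fun x₂ _ => hs _
  rw [LinearMap.sum_apply]
  let q : Bool → Bool → Bool → Bool → ℝ := fun x₁ x₂ x a => s.1 ((⟨(), x₁⟩, ⟨(), x₂⟩), ⟨x, a⟩)
  -- For fixed x₁, x₂ the sum over z runs over all outputs of the box at input x₁ + x₂;
  -- no-signalling moves it to the reference input used by the unit effect.
  have hNS : ∀ x₁ x₂ x x' : Bool, ∑ a, q x₁ x₂ x a = ∑ a, q x₁ x₂ x' a := fun x₁ x₂ =>
    s.2.2 (⟨(), x₁⟩, ⟨(), x₂⟩)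
  change ∑ z, ∑ x₁, ∑ x₂, q x₁ x₂ (x₁ ^^ x₂) (z ^^ x₁) =
    ∑ a, ∑ x₂, ∑ x₁, q x₁ x₂ (Classical.arbitrary Bool) a
  generalize Classical.arbitrary Bool = x
  have h := fun x₁ x₂ => hNS x₁ x₂ (x₁ ^^ x₂) x
  simp only [Fintype.sum_bool] at h ⊢
  have h1 := h true true
  have h2 := h true false
  have h3 := h false true
  have h4 := h false false
  simp at h1 h2 h3 h4 ⊢
  linarith

theorem decode_mem (i : Bool) : decode i ∈
    BoxSpace.Meas (space (comp (box (Box.classical Bool)) (box Box.binary))) Bool := by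
  refine BoxSpace.meas_of_nonneg (fun y s hs => ?_) (LinearMap.ext fun s => ?_)
  · change 0 ≤ ∑ z : Bool, s.1 (⟨(), z⟩, ⟨i, z ^^ y⟩)
    exact Finset.sum_nonneg fun z _ => hs _
  rw [LinearMap.sum_apply]
  let q : Bool → Bool → Bool → ℝ := fun z x a => s.1 (⟨(), z⟩, ⟨x, a⟩)
  have hNS : ∀ z x x' : Bool, ∑ a, q z x a = ∑ a, q z x' a := fun z => s.2.2 ⟨(), z⟩
  change ∑ y, ∑ z, q z i (z ^^ y) = ∑ a, ∑ z, q z (Classical.arbitrary Bool) a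
  generalize Classical.arbitrary Bool = x
  have h1 := hNS true i x
  have h2 := hNS false i x
  simp only [Fintype.sum_bool] at h1 h2 ⊢
  simp at h1 h2 ⊢
  linarith

end BoxSys

/-! ### Van Dam's strategy and its entropies -/

open BoxSys in
/-- The strategy of van Dam, which uses one Popescu–Rohrlich box. -/
noncomputable def vanDam : ICStrategy boxWorld Bool Bool Bool Bool where
  input := fun _ => 1 / 4
  input_mem := ⟨fun _ => by norm_num, by norm_num [Fintype.sum_prod_type]⟩
  AZ := box Box.binary
  AY := box Box.binary
  resource := prBox
  resource_mem := prBox_mem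
  measZ := encode
  measZ_mem := encode_mem
  measY := fun i => decode (i == 1)
  measY_mem := fun i => decode_mem _

namespace vanDam

theorem effectZ_apply (x : Bool × Bool) (z : Bool) (s : (Box.binary.space).NS) :
    vanDam.effectZ x z s = s.1 ⟨x.1 ^^ x.2, z ^^ x.1⟩ := by
  -- The entries of the deterministic states are written as readouts so that `BoxSys.readout_pt`
  -- collapses the sums to the actual inputs.
  change ∑ x₁ : Bool, ∑ x₂ : Bool, (BoxSys.readout x₁ (BoxSys.pt x.1) * BoxSys.readout x₂ (BoxSys.pt x.2)) *
    s.1 ⟨x₁ ^^ x₂, z ^^ x₁⟩ = _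
  obtain ⟨x₁, x₂⟩ := x
  simp [BoxSys.readout_pt]

theorem effectY_apply (i : Fin 2) (z y : Bool) (s : (Box.binary.space).NS) :
    vanDam.effectY i z y s = s.1 ⟨i == 1, z ^^ y⟩ := by
  change ∑ z' : Bool, BoxSys.readout z' (BoxSys.pt z) * s.1 ⟨i == 1, z' ^^ y⟩ = _
  simp [BoxSys.readout_pt]

theorem probZY_eq (i : Fin 2) (x : Bool × Bool) (z y : Bool) :
    vanDam.probZY i x z y = if y = (if i = 0 then x.1 else x.2) then 1 / 2 else 0 := by
  -- In box world e ⊗ f is f applied after e ⊗ I, so the two local effects just read off one entry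
  -- of the box.
  refine (effectY_apply i z y _).trans ((effectZ_apply x z _).trans ?_)
  -- The message cancels: the relation says x₁ + y = 0 for index 0 (the question R = 1) and x₁ + y =
  -- x₁ + x₂ for index 1 (R = 2).
  change (if ((z ^^ x.1) ^^ (z ^^ y)) = ((x.1 ^^ x.2) && (i == 1)) then (1 / 2 : ℝ) else 0) = _
  obtain ⟨x₁, x₂⟩ := x
  fin_cases i <;> cases x₁ <;> cases x₂ <;> cases y <;> cases z <;> simp

theorem joint_apply (i : Fin 2) (x₁ x₂ z y : Bool) :
    vanDam.joint i (x₁, x₂, z, y) = if y = (if i = 0 then x₁ else x₂) then 1 / 8 else 0 := by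
  rw [ICStrategy.joint_eq, probZY_eq]
  change 1 / 4 * _ = _
  rw [mul_ite, mul_zero]
  norm_num

theorem lawZ_eq (z : Bool) : vanDam.lawZ z = 1 / 2 := by
  have h : ∀ x, vanDam.probZ x z = 1 / 2 := fun x => by
    rw [← vanDam.sum_probZY 0]
    simp [probZY_eq]
  simp only [ICStrategy.lawZ, h]
  change ∑ _, 1 / 4 * _ = _
  norm_num [Fintype.sum_prod_type]

theorem entropy_half {p : Bool → ℝ} (h : ∀ a, p a = 1 / 2) : shannonEntropy p = 1 := by
  have hl : Real.logb 2 (1 / 2) = -1 := by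
    rw [one_div, Real.logb_inv, Real.logb_self_eq_one one_lt_two]
  rw [shannonEntropy, Fintype.sum_bool, h, h, hl]
  norm_num

/-- A perfectly correlated pair carries the entropy of one fair bit, so the mutual informations
below are 1 + 1 - 1. -/
theorem entropy_diagonal {p : Bool × Bool → ℝ} (h : ∀ a b, p (a, b) = if b = a then 1 / 2 else 0) :
    shannonEntropy p = 1 := by
  rw [← entropy_half fun _ => rfl]
  simp [shannonEntropy, Fintype.sum_prod_type, h]

theorem mutualInfo_zero :
    mutualInfo (vanDam.joint 0) (fun ω => ω.1) (fun ω => ω.2.2.2) = 1 := by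
  rw [mutualInfo, entropy_half, entropy_half, entropy_diagonal]
  · norm_num
  · intro a b
    rw [lawOf_apply]
    cases a <;> cases b <;> norm_num [Fintype.sum_prod_type, joint_apply]
  · intro b
    rw [lawOf_apply]
    cases b <;> norm_num [Fintype.sum_prod_type, joint_apply]
  · intro a
    rw [lawOf_apply]
    cases a <;> norm_num [Fintype.sum_prod_type, joint_apply]

theorem mutualInfo_one :
    mutualInfo (vanDam.joint 1) (fun ω => ω.2.1) (fun ω => ω.2.2.2) = 1 := by
  rw [mutualInfo, entropy_half, entropy_half, entropy_diagonal]
  · norm_num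
  · intro a b
    rw [lawOf_apply]
    cases a <;> cases b <;> norm_num [Fintype.sum_prod_type, joint_apply]
  · intro b
    rw [lawOf_apply]
    cases b <;> norm_num [Fintype.sum_prod_type, joint_apply]
  · intro a
    rw [lawOf_apply]
    cases a <;> norm_num [Fintype.sum_prod_type, joint_apply]

end vanDam

theorem mainTheorem10 :
    (∀ (G : GPT.{u, v, w}) (X₁ X₂ Z Y : Type) [Fintype X₁] [Fintype X₂] [Fintype Z] [Fintype Y]
      [Nonempty X₁] [Nonempty X₂] [Nonempty Z] (S : ICStrategy G X₁ X₂ Z Y) (i : Fin 2),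
      mutualInfo (S.joint i) (fun ω => (ω.1, ω.2.1)) (fun ω => (ω.2.2.2, ω.2.2.1))
        ≤ shannonEntropy S.lawZ) ∧
    (∃ S : ICStrategy boxWorld Bool Bool Bool Bool, (∀ x, S.input x = 1 / 4) ∧
      shannonEntropy S.lawZ <
        mutualInfo (S.joint 0) (fun ω => ω.1) (fun ω => ω.2.2.2) +
          mutualInfo (S.joint 1) (fun ω => ω.2.1) (fun ω => ω.2.2.2)) := by
  refine ⟨fun G X₁ X₂ Z Y _ _ _ _ _ _ _ S i => S.mutualInfo_le i, vanDam, fun _ => rfl, ?_⟩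
  rw [vanDam.mutualInfo_zero, vanDam.mutualInfo_one, vanDam.entropy_half vanDam.lawZ_eq]
  norm_num
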